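/- Let $A$ and $B$ be finite-dimensional quantum systems, with $\dim A\ge 1$, and let $\Phi:\mathbb{L}(A)\to\mathbb{L}(B)$ be a linear map between the spaces of linear operators on their Hilbert spaces that is Hermiticity-preserving (it maps Hermitian operators to Hermitian operators) and trace preserving ($\operatorname{Tr}\Phi(Z)=\operatorname{Tr}Z$ for all $Z$). Let $\|\cdot\|_1$ be the trace norm. Call a linear map $\Lambda:\mathbb{L}(C)\to\mathbb{L}(D)$ CPTNI if it is completely positive ($\mathrm{id}_C\otimes\Lambda$ maps positive semidefinite operators to positive semidefinite operators) and trace non-increasing ($\operatorname{Tr}\Lambda(Z)\le\operatorname{Tr}Z$ for all $Z\ge 0$). Define \[ \|\Phi\|_\diamond=\max\bigl\{\|(\mathrm{id}_A\otimes\Phi)(\rho)\|_1 \;:\; \rho\in\mathbb{L}(A\otimes A),\ \rho\ge 0,\ \operatorname{Tr}\rho=1\bigr\}, \] \[ S(\Phi)=\min\bigl\{\|X\|_1 \;:\; \Lambda(\cdot\otimes X)=\Phi(\cdot),\ \operatorname{Tr}X=1,\ \Lambda \text{ CPTNI}\bigr\}, \] \[ S_A(\Phi)=\min\Bigl\{\frac{\|X\|_1}{\|Y\|_1}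 \;:\; \Lambda(\cdot\otimes X)=\Phi(\cdot)\otimes Y,\ \operatorname{Tr}X=\operatorname{Tr}Y=1,\ \Lambda \text{ CPTNI}\Bigr\}, \] where $X$ and $Y$ range over Hermitian operators on ancillary systems $A'$ and $B'$ of arbitrary finite dimensions, and $\Lambda$ ranges over the CPTNI maps $\mathbb{L}(A\otimes A')\to\mathbb{L}(B)$ in the definition of $S$, and $\mathbb{L}(A\otimes A')\to\mathbb{L}(B\otimes B')$ in the definition of $S_A$. Then the maximum and both minima are attained, and \[ S_A(\Phi)=S(\Phi)=\|\Phi\|_\diamond . \] -/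

import Mathlib

open scoped Kronecker ComplexOrder

noncomputable section

namespace LinearMapSimulation

/- A finite-dimensional quantum system is a finite index type `a` (an orthonormal basis of its
Hilbert space); `Matrix a a ℂ` is the space of all linear operators on it, `a × r` is the
composite system, `⊗ₖ` is the tensor product of operators. -/

variable {a b : Type*} [Fintype a] [DecidableEq a] [Fintype b] [DecidableEq b]

/-- The trace norm (Schatten 1-norm): the sum of the singular values of `X`, that is, of the
square roots of the eigenvalues of `Xᴴ * X`. -/
def traceNorm (X : Matrix a a ℂ) : ℝ :=
  ∑ i, √((Matrix.isHermitian_conjTranspose_mul_self X).eigenvalues i)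

/-- Density operators: positive semidefinite with unit trace. -/
def IsDensity (ρ : Matrix a a ℂ) : Prop :=
  ρ.PosSemidef ∧ ρ.trace = 1

/-- `Φ` maps Hermitian operators to Hermitian operators. -/
def IsHermitianPreserving (Φ : Matrix a a ℂ →ₗ[ℂ] Matrix b b ℂ) : Prop :=
  ∀ X : Matrix a a ℂ, X.IsHermitian → (Φ X).IsHermitian

/-- `Tr Φ(X) = Tr X` for all `X`. -/
def IsTracePreserving (Φ : Matrix a a ℂ →ₗ[ℂ] Matrix b b ℂ) : Prop :=
  ∀ X : Matrix a a ℂ, (Φ X).trace = X.trace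

/-- `Tr Φ(X) ≤ Tr X` for all positive semidefinite `X`. -/
def IsTraceNonincreasing (Φ : Matrix a a ℂ →ₗ[ℂ] Matrix b b ℂ) : Prop :=
  ∀ X : Matrix a a ℂ, X.PosSemidef → (Φ X).trace.re ≤ X.trace.re

/-- The map `id ⊗ Φ`, where `id` is the identity map on the operators of a reference system `r`:
regarding an operator on `r × a` as a block matrix with blocks in `Matrix a a ℂ`, it applies `Φ`
to every block. -/
def idTensor (r : Type*) (Φ : Matrix a a ℂ →ₗ[ℂ] Matrix b b ℂ) :
    Matrix (r × a) (r × a) ℂ →ₗ[ℂ] Matrix (r × b) (r × b) ℂ where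
  toFun M := Matrix.of fun p q => Φ (M.submatrix (Prod.mk p.1) (Prod.mk q.1)) p.2 q.2
  map_add' M N := by
    ext p q
    simp [Matrix.submatrix_add]
  map_smul' c M := by
    ext p q
    simp [Matrix.submatrix_smul]

/-- `id ⊗ Φ` is positive, the reference system being a copy of the input system. -/
def IsCompletelyPositive (Φ : Matrix a a ℂ →ₗ[ℂ] Matrix b b ℂ) : Prop :=
  ∀ M : Matrix (a × a) (a × a) ℂ, M.PosSemidef → (idTensor a Φ M).PosSemidef

/-- Completely positive and trace non-increasing maps. -/
def IsCPTNI (Φ : Matrix a a ℂ →ₗ[ℂ] Matrix b b ℂ) : Prop :=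
  IsCompletelyPositive Φ ∧ IsTraceNonincreasing Φ

/-- The numbers `‖(id ⊗ Φ)(ρ)‖₁`, where `ρ` is a density operator on two copies of the input. -/
def diamondValues (Φ : Matrix a a ℂ →ₗ[ℂ] Matrix b b ℂ) : Set ℝ :=
  {t | ∃ ρ : Matrix (a × a) (a × a) ℂ, IsDensity ρ ∧ t = traceNorm (idTensor a Φ ρ)}

/-- The diamond norm of a Hermiticity-preserving map. -/
def diamondNorm (Φ : Matrix a a ℂ →ₗ[ℂ] Matrix b b ℂ) : ℝ :=
  sSup (diamondValues Φ)

/-- The numbers `‖X‖₁`, where `X` is a Hermitian operator of unit trace on an ancilla of arbitrary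
finite dimension and some CPTNI map `Λ` satisfies `Λ(· ⊗ X) = Φ(·)`. -/
def simulationValues (Φ : Matrix a a ℂ →ₗ[ℂ] Matrix b b ℂ) : Set ℝ :=
  {t | ∃ (n : ℕ) (X : Matrix (Fin n) (Fin n) ℂ)
      (Λ : Matrix (a × Fin n) (a × Fin n) ℂ →ₗ[ℂ] Matrix b b ℂ),
      X.IsHermitian ∧ X.trace = 1 ∧ IsCPTNI Λ ∧
      (∀ Z : Matrix a a ℂ, Λ (Z ⊗ₖ X) = Φ Z) ∧
      t = traceNorm X}

/-- The simulation cost `S(Φ)`. -/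
def simulationCost (Φ : Matrix a a ℂ →ₗ[ℂ] Matrix b b ℂ) : ℝ :=
  sInf (simulationValues Φ)

/-- The numbers `‖X‖₁ / ‖Y‖₁`, where `X` and `Y` are Hermitian operators of unit trace on ancillas
of arbitrary finite dimensions and some CPTNI map `Λ` satisfies `Λ(· ⊗ X) = Φ(·) ⊗ Y`. -/
def amortisedValues (Φ : Matrix a a ℂ →ₗ[ℂ] Matrix b b ℂ) : Set ℝ :=
  {t | ∃ (n m : ℕ) (X : Matrix (Fin n) (Fin n) ℂ) (Y : Matrix (Fin m) (Fin m) ℂ)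
      (Λ : Matrix (a × Fin n) (a × Fin n) ℂ →ₗ[ℂ] Matrix (b × Fin m) (b × Fin m) ℂ),
      X.IsHermitian ∧ Y.IsHermitian ∧ X.trace = 1 ∧ Y.trace = 1 ∧ IsCPTNI Λ ∧
      (∀ Z : Matrix a a ℂ, Λ (Z ⊗ₖ X) = Φ Z ⊗ₖ Y) ∧
      t = traceNorm X / traceNorm Y}

/-- The amortised simulation cost `S_A(Φ)`. -/
def amortisedCost (Φ : Matrix a a ℂ →ₗ[ℂ] Matrix b b ℂ) : ℝ :=
  sInf (amortisedValues Φ)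

end LinearMapSimulation

end

open LinearMapSimulation

open scoped Matrix

set_option linter.unusedSectionVars false

/-! Write `d` for the diamond norm. It is an attained maximum because density operators form a
compact set and the trace norm is continuous on Hermitian operators.

Lower bound: if `Λ(· ⊗ X) = Φ(·) ⊗ Y`, then `id ⊗ Λ` sends `ρ ⊗ X` to `(id ⊗ Φ)(ρ) ⊗ Y`. Contraction
under CPTNI maps and multiplicativity of the trace norm give `‖(id ⊗ Φ)(ρ)‖₁ ‖Y‖₁ ≤ ‖X‖₁`
(`le_of_mem_diamondValues_of_mem_amortisedValues`). A simulation is an amortised one with trivial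
`Y`, so it only remains to simulate `Φ` at cost `d`.

Upper bound: put `c = (d + 1) / 2` and let `J` be the Choi operator of `Φ`. If some `P ≥ 0` has `P ≥
J` and `Tr_B P ≤ c • 1`, then `N = P - J` has `Tr_B N ≤ (c - 1) • 1`, since `Φ` preserves the trace.
Measuring the ancilla `diag(c, -(c - 1))`, of trace `1` and trace norm `2c - 1 = d`, selects one of
the CPTNI maps with Choi operators `P / c` and `N / (c - 1)`, and the signed sum is `Φ`
(`mem_simulationValues`).

Such a `P` comes from convex duality (`exists_dominating`). Otherwise Hahn–Banach yields a weight `σ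
≥ 0` with `Tr(σ Tr_B P)` bounded away above `c Tr σ` for all admissible `P`. After making `σ`
positive definite, an explicit `P` built from the positive part of `(√σ ⊗ 1) J (√σ ⊗ 1)` contradicts
this (`exists_dominating_of_posDef`). -/

namespace LinearMapSimulation

/-! ### Spectral theorem and positive square roots -/

section MatrixOrder

open scoped MatrixOrder

/-- The spectral theorem, in terms of plain matrix products. -/
theorem exists_unitary_diagonal {n : Type*} [Fintype n] [DecidableEq n] {X : Matrix n n ℂ}
    (hX : X.IsHermitian) : ∃ U : Matrix n n ℂ, Uᴴ * U = 1 ∧ U * Uᴴ = 1 ∧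
      X = U * Matrix.diagonal (fun i => (hX.eigenvalues i : ℂ)) * Uᴴ := by
  refine ⟨hX.eigenvectorUnitary, ?_, ?_, ?_⟩
  · exact (Unitary.mem_iff.mp hX.eigenvectorUnitary.2).1
  · exact (Unitary.mem_iff.mp hX.eigenvectorUnitary.2).2
  · conv_lhs => rw [hX.spectral_theorem, Unitary.conjStarAlgAut_apply]
    rfl

theorem posSemidef_sqrt_unique {n : Type*} [Fintype n] [DecidableEq n] {S T : Matrix n n ℂ}
    (hS : S.PosSemidef) (hT : T.PosSemidef) (h : S * S = T * T) : S = T := by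
  have h1 := CFC.sqrt_unique (a := T * T) (b := S) h (Matrix.nonneg_iff_posSemidef.mpr hS)
  have h2 := CFC.sqrt_unique (a := T * T) (b := T) rfl (Matrix.nonneg_iff_posSemidef.mpr hT)
  exact h1.symm.trans h2

theorem exists_posSemidef_sqrt {n : Type*} [Fintype n] [DecidableEq n] {M : Matrix n n ℂ}
    (hM : M.PosSemidef) : ∃ S : Matrix n n ℂ, S.PosSemidef ∧ S * S = M :=
  ⟨CFC.sqrt M, Matrix.nonneg_iff_posSemidef.mp (CFC.sqrt_nonneg M),
    CFC.sqrt_mul_sqrt_self M (Matrix.nonneg_iff_posSemidef.mpr hM)⟩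

end MatrixOrder

/-! ### Trace norm -/

section TraceNorm

variable {n m : Type*} [Fintype n] [DecidableEq n] [Fintype m] [DecidableEq m]

theorem conj_diagonal_mul {U : Matrix n n ℂ} (hU : Uᴴ * U = 1) (d e : n → ℂ) :
    (U * Matrix.diagonal d * Uᴴ) * (U * Matrix.diagonal e * Uᴴ)
      = U * Matrix.diagonal (d * e) * Uᴴ := by
  calc _ = U * Matrix.diagonal d * (Uᴴ * U) * Matrix.diagonal e * Uᴴ := by
        simp only [Matrix.mul_assoc]
    _ = _ := by
        rw [hU, Matrix.mul_one, Matrix.mul_assoc U, Matrix.diagonal_mul_diagonal]; rfl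

theorem trace_conj_diagonal {U : Matrix n n ℂ} (hU : Uᴴ * U = 1) (d : n → ℂ) :
    (U * Matrix.diagonal d * Uᴴ).trace = ∑ i, d i := by
  rw [Matrix.mul_assoc, Matrix.trace_mul_comm, Matrix.mul_assoc, hU, Matrix.mul_one,
    Matrix.trace_diagonal]

theorem posSemidef_conj_diagonal (U : Matrix n n ℂ) {d : n → ℝ} (hd : ∀ i, 0 ≤ d i) :
    (U * Matrix.diagonal (fun i => (d i : ℂ)) * Uᴴ).PosSemidef :=
  (Matrix.PosSemidef.diagonal (fun i => by simpa using hd i)).mul_mul_conjTranspose_same U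

/-- By uniqueness of positive square roots `S` is `|X|`. Trace norms can thus be computed by
exhibiting a square root, without tracking eigenvalues. -/
theorem traceNorm_eq_of_mul_self {X S : Matrix n n ℂ} (hS : S.PosSemidef)
    (h : S * S = Xᴴ * X) : traceNorm X = S.trace.re := by
  have hH := Matrix.isHermitian_conjTranspose_mul_self X
  obtain ⟨U, hU, -, hX⟩ := exists_unitary_diagonal hH
  have hnn : ∀ i, 0 ≤ hH.eigenvalues i := Matrix.eigenvalues_conjTranspose_mul_self_nonneg X
  have : S = U * Matrix.diagonal (fun i => ((√(hH.eigenvalues i) : ℝ) : ℂ)) * Uᴴ := by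
    refine posSemidef_sqrt_unique hS (posSemidef_conj_diagonal U fun i => Real.sqrt_nonneg _) ?_
    rw [conj_diagonal_mul hU, h]
    conv_lhs => rw [hX]
    congr 3
    ext i
    simp only [Pi.mul_apply]
    rw [← Complex.ofReal_mul, Real.mul_self_sqrt (hnn i)]
  rw [this, trace_conj_diagonal hU]
  simp [traceNorm]

theorem exists_posSemidef_mul_self (X : Matrix n n ℂ) :
    ∃ S : Matrix n n ℂ, S.PosSemidef ∧ S * S = Xᴴ * X ∧ traceNorm X = S.trace.re := by
  obtain ⟨S, hS, h⟩ := exists_posSemidef_sqrt (Matrix.posSemidef_conjTranspose_mul_self X)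
  exact ⟨S, hS, h, traceNorm_eq_of_mul_self hS h⟩

theorem trace_re_nonneg {P : Matrix n n ℂ} (hP : P.PosSemidef) : 0 ≤ P.trace.re :=
  (Complex.le_def.mp hP.trace_nonneg).1

theorem trace_im_eq_zero {P : Matrix n n ℂ} (hP : P.IsHermitian) : P.trace.im = 0 := by
  have h : star P.trace = P.trace := by rw [← Matrix.trace_conjTranspose, hP.eq]
  simpa using Complex.conj_eq_iff_im.mp h

theorem trace_mul_re_nonneg {P Q : Matrix n n ℂ} (hP : P.PosSemidef) (hQ : Q.PosSemidef) :
    0 ≤ (P * Q).trace.re := by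
  obtain ⟨S, hS, rfl⟩ := exists_posSemidef_sqrt hP
  rw [Matrix.mul_assoc, Matrix.trace_mul_comm]
  have := hQ.mul_mul_conjTranspose_same S
  rw [hS.isHermitian.eq] at this
  exact trace_re_nonneg this

theorem traceNorm_kronecker (X : Matrix n n ℂ) (Y : Matrix m m ℂ) :
    traceNorm (X ⊗ₖ Y) = traceNorm X * traceNorm Y := by
  obtain ⟨S, hS, h, hX⟩ := exists_posSemidef_mul_self X
  obtain ⟨T, hT, h', hY⟩ := exists_posSemidef_mul_self Y
  rw [hX, hY, traceNorm_eq_of_mul_self (hS.kronecker hT), Matrix.trace_kronecker, Complex.mul_re,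
    trace_im_eq_zero hS.isHermitian]
  · simp
  · rw [Matrix.conjTranspose_kronecker, ← Matrix.mul_kronecker_mul, ← Matrix.mul_kronecker_mul,
      h, h']

theorem traceNorm_submatrix_equiv (X : Matrix n n ℂ) (e : m ≃ n) :
    traceNorm (X.submatrix e e) = traceNorm X := by
  obtain ⟨S, hS, h, hX⟩ := exists_posSemidef_mul_self X
  rw [hX, traceNorm_eq_of_mul_self (hS.submatrix e)]
  · rw [Matrix.trace, Matrix.trace]
    exact congrArg _ (Equiv.sum_comp e fun i => S i i)
  · rw [Matrix.conjTranspose_submatrix, Matrix.submatrix_mul_equiv, Matrix.submatrix_mul_equiv, h]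

theorem traceNorm_posSemidef {P : Matrix n n ℂ} (hP : P.PosSemidef) :
    traceNorm P = P.trace.re :=
  traceNorm_eq_of_mul_self hP (by rw [hP.isHermitian.eq])

theorem traceNorm_neg (X : Matrix n n ℂ) : traceNorm (-X) = traceNorm X := by
  obtain ⟨S, hS, h, hX⟩ := exists_posSemidef_mul_self X
  rw [hX, traceNorm_eq_of_mul_self hS (by simpa using h)]

theorem traceNorm_smul {s : ℝ} (hs : 0 ≤ s) (X : Matrix n n ℂ) :
    traceNorm ((s : ℂ) • X) = s * traceNorm X := by
  obtain ⟨S, hS, h, hX⟩ := exists_posSemidef_mul_self X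
  have hs' : (0 : ℂ) ≤ s := by simpa using hs
  rw [hX, traceNorm_eq_of_mul_self (hS.smul hs')]
  · simp [Matrix.trace_smul]
  · simp [Matrix.conjTranspose_smul, h]

/-- The Jordan decomposition of a Hermitian operator. -/
theorem exists_jordan_decomposition {X : Matrix n n ℂ} (hX : X.IsHermitian) :
    ∃ P N : Matrix n n ℂ, P.PosSemidef ∧ N.PosSemidef ∧ X = P - N ∧
      traceNorm X = P.trace.re + N.trace.re := by
  obtain ⟨U, hU, -, h⟩ := exists_unitary_diagonal hX
  set d := hX.eigenvalues
  have hP := posSemidef_conj_diagonal U (d := fun i => max (d i) 0) fun i => le_max_right _ _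
  have hN := posSemidef_conj_diagonal U (d := fun i => max (-d i) 0) fun i => le_max_right _ _
  refine ⟨_, _, hP, hN, ?_, ?_⟩
  · rw [← Matrix.sub_mul, ← Matrix.mul_sub, Matrix.diagonal_sub]
    conv_lhs => rw [h]
    congr 3
    ext i
    rw [← Complex.ofReal_sub]
    congr 1
    rcases le_total 0 (d i) with hd | hd <;> simp [hd]
  · rw [← Complex.add_re, ← Matrix.trace_add]
    refine traceNorm_eq_of_mul_self (hP.add hN) ?_
    rw [hX.eq, ← Matrix.add_mul, ← Matrix.mul_add, Matrix.diagonal_add, conj_diagonal_mul hU]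
    conv_rhs => rw [h, conj_diagonal_mul hU]
    congr 3
    ext i
    simp only [Pi.mul_apply]
    rw [← Complex.ofReal_add, ← Complex.ofReal_mul, ← Complex.ofReal_mul]
    congr 1
    rcases le_total 0 (d i) with hd | hd <;> simp [hd]

/-- The trace norm of a Hermitian operator is attained by pairing it with its sign. -/
theorem exists_sign {X : Matrix n n ℂ} (hX : X.IsHermitian) :
    ∃ W : Matrix n n ℂ, (1 - W).PosSemidef ∧ (1 + W).PosSemidef ∧
      traceNorm X = (W * X).trace.re := by
  obtain ⟨U, hU, hU', h⟩ := exists_unitary_diagonal hX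
  set d := hX.eigenvalues
  set s : n → ℝ := fun i => if 0 ≤ d i then 1 else -1
  have h1 : (1 : Matrix n n ℂ) = U * Matrix.diagonal (fun _ => ((1 : ℝ) : ℂ)) * Uᴴ := by
    simp [hU']
  refine ⟨U * Matrix.diagonal (fun i => (s i : ℂ)) * Uᴴ, ?_, ?_, ?_⟩
  · rw [h1, ← Matrix.sub_mul, ← Matrix.mul_sub, Matrix.diagonal_sub]
    simp_rw [← Complex.ofReal_sub]
    refine posSemidef_conj_diagonal U fun i => ?_
    by_cases hd : 0 ≤ d i <;> simp [s, hd]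
  · rw [h1, ← Matrix.add_mul, ← Matrix.mul_add, Matrix.diagonal_add]
    simp_rw [← Complex.ofReal_add]
    refine posSemidef_conj_diagonal U fun i => ?_
    by_cases hd : 0 ≤ d i <;> simp [s, hd]
  · have key : (U * Matrix.diagonal (fun i => (s i : ℂ)) * Uᴴ) * X
        = U * Matrix.diagonal (fun i => ((|d i| : ℝ) : ℂ)) * Uᴴ := by
      conv_lhs => rw [h, conj_diagonal_mul hU]
      congr 3
      ext i
      simp only [Pi.mul_apply]
      rw [← Complex.ofReal_mul]
      congr 1
      by_cases hd : 0 ≤ d i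
      · simp [s, hd, abs_of_nonneg hd]
      · simp [s, hd, abs_of_neg (not_le.mp hd)]
    rw [key]
    refine traceNorm_eq_of_mul_self (posSemidef_conj_diagonal U fun i => abs_nonneg _) ?_
    rw [hX.eq, conj_diagonal_mul hU]
    conv_rhs => rw [h, conj_diagonal_mul hU]
    congr 3
    ext i
    simp only [Pi.mul_apply]
    rw [← Complex.ofReal_mul, ← Complex.ofReal_mul, abs_mul_abs_self]

/-- The sign `W` of `P - N` satisfies `-1 ≤ W ≤ 1`, so `Tr(WP) ≤ Tr P` and `-Tr(WN) ≤ Tr N`. Hence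
the Jordan decomposition is the cheapest one. -/
theorem traceNorm_sub_le {P N : Matrix n n ℂ} (hP : P.PosSemidef) (hN : N.PosSemidef) :
    traceNorm (P - N) ≤ P.trace.re + N.trace.re := by
  obtain ⟨W, h1, h2, hW⟩ := exists_sign (hP.isHermitian.sub hN.isHermitian)
  have hp := trace_mul_re_nonneg h1 hP
  have hn := trace_mul_re_nonneg h2 hN
  rw [Matrix.sub_mul, Matrix.one_mul, Matrix.trace_sub, Complex.sub_re] at hp
  rw [Matrix.add_mul, Matrix.one_mul, Matrix.trace_add, Complex.add_re] at hn
  rw [hW, Matrix.mul_sub, Matrix.trace_sub, Complex.sub_re]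
  linarith

theorem traceNorm_add_le {X Y : Matrix n n ℂ} (hX : X.IsHermitian) (hY : Y.IsHermitian) :
    traceNorm (X + Y) ≤ traceNorm X + traceNorm Y := by
  obtain ⟨P, N, hP, hN, rfl, h⟩ := exists_jordan_decomposition hX
  obtain ⟨P', N', hP', hN', rfl, h'⟩ := exists_jordan_decomposition hY
  have := traceNorm_sub_le (hP.add hP') (hN.add hN')
  rw [Matrix.trace_add, Matrix.trace_add, Complex.add_re, Complex.add_re] at this
  rw [h, h', show P - N + (P' - N') = P + P' - (N + N') by abel]
  linarith

theorem trace_re_le_traceNorm {X : Matrix n n ℂ} (hX : X.IsHermitian) :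
    X.trace.re ≤ traceNorm X := by
  obtain ⟨P, N, hP, hN, rfl, h⟩ := exists_jordan_decomposition hX
  rw [h, Matrix.trace_sub, Complex.sub_re]
  linarith [trace_re_nonneg hN]

/-- Cauchy–Schwarz on the singular values. The right side is visibly continuous in the entries,
which gives continuity of the trace norm. -/
theorem traceNorm_le_sqrt (X : Matrix n n ℂ) :
    traceNorm X ≤ √(Fintype.card n * (Xᴴ * X).trace.re) := by
  have hH := Matrix.isHermitian_conjTranspose_mul_self X
  have hnn : ∀ i, 0 ≤ hH.eigenvalues i := Matrix.eigenvalues_conjTranspose_mul_self_nonneg X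
  refine Real.le_sqrt_of_sq_le ?_
  have h := sq_sum_le_card_mul_sum_sq (s := Finset.univ) (f := fun i => √(hH.eigenvalues i))
  refine h.trans (le_of_eq ?_)
  rw [Finset.card_univ, hH.trace_eq_sum_eigenvalues]
  simp [Real.sq_sqrt (hnn _)]

theorem continuousOn_traceNorm :
    ContinuousOn (traceNorm : Matrix n n ℂ → ℝ) {X | X.IsHermitian} := by
  intro X hX
  have hb : Filter.Tendsto (fun Y : Matrix n n ℂ =>
      √(Fintype.card n * ((Y - X)ᴴ * (Y - X)).trace.re)) (nhdsWithin X {X | X.IsHermitian})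
      (nhds 0) := by
    have hc : Continuous (fun Y : Matrix n n ℂ =>
        √(Fintype.card n * ((Y - X)ᴴ * (Y - X)).trace.re)) := by fun_prop
    have := hc.tendsto X
    simp only [sub_self, Matrix.conjTranspose_zero, Matrix.trace_zero,
      Complex.zero_re, mul_zero, Real.sqrt_zero] at this
    exact this.mono_left nhdsWithin_le_nhds
  refine tendsto_iff_dist_tendsto_zero.mpr (squeeze_zero' ?_ ?_ hb)
  · exact Filter.Eventually.of_forall fun _ => dist_nonneg
  · filter_upwards [self_mem_nhdsWithin] with Y hY
    have hYX : (Y - X).IsHermitian := Matrix.IsHermitian.sub hY hX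
    have h1 := traceNorm_add_le hX hYX
    have h2 := traceNorm_add_le hY hYX.neg
    rw [add_sub_cancel] at h1
    rw [traceNorm_neg, show Y + -(Y - X) = X by abel] at h2
    rw [Real.dist_eq]
    refine le_trans ?_ (traceNorm_le_sqrt (Y - X))
    rw [abs_le]
    constructor <;> linarith

end TraceNorm

/-! ### Extension by a reference system -/

section IdTensor

variable {a b n r s : Type*} [Fintype a] [DecidableEq a] [Fintype b] [DecidableEq b]
  [Fintype n] [DecidableEq n]
  [Fintype r] [DecidableEq r] [Fintype s] [DecidableEq s]

theorem idTensor_submatrix (Φ : Matrix a a ℂ →ₗ[ℂ] Matrix b b ℂ) (M : Matrix (r × a) (r × a) ℂ)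
    (g : s → r) : idTensor s Φ (M.submatrix (Prod.map g id) (Prod.map g id))
      = (idTensor r Φ M).submatrix (Prod.map g id) (Prod.map g id) := rfl

/-- The reference system in the definition of complete positivity may be replaced by any system
embedding into it. -/
theorem IsCompletelyPositive.posSemidef_idTensor {Φ : Matrix a a ℂ →ₗ[ℂ] Matrix b b ℂ}
    (hΦ : IsCompletelyPositive Φ) {i : r → a} {p : a → r} (hip : ∀ x, p (i x) = x)
    {M : Matrix (r × a) (r × a) ℂ} (hM : M.PosSemidef) : (idTensor r Φ M).PosSemidef := by
  -- Pull `M` back along `p` to the reference of the definition, apply positivity there, then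
  -- restrict along `i`; reindexing the reference commutes with `id ⊗ Φ`.
  have h := (hΦ _ (hM.submatrix (Prod.map p id))).submatrix (Prod.map i id)
  rw [← idTensor_submatrix] at h
  convert h using 2
  ext ⟨x, k⟩ ⟨y, l⟩
  simp [hip]

theorem kronecker_one_mul_apply (V : Matrix s r ℂ) (M : Matrix (r × a) n ℂ) (x : s) (k : a)
    (y : n) : ((V ⊗ₖ (1 : Matrix a a ℂ)) * M) (x, k) y = ∑ z, V x z * M (z, k) y := by
  simp [Matrix.mul_apply, Fintype.sum_prod_type, Matrix.one_apply]

theorem mul_kronecker_one_apply (V : Matrix r s ℂ) (M : Matrix n (r × a) ℂ) (x : s) (k : a)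
    (y : n) : (M * (V ⊗ₖ (1 : Matrix a a ℂ))) y (x, k) = ∑ z, M y (z, k) * V z x := by
  simp [Matrix.mul_apply, Fintype.sum_prod_type, Matrix.one_apply]

theorem one_kronecker_mul_apply (C : Matrix b a ℂ) (M : Matrix (r × a) n ℂ) (x : r) (k : b)
    (y : n) : (((1 : Matrix r r ℂ) ⊗ₖ C) * M) (x, k) y = ∑ i, C k i * M (x, i) y := by
  simp [Matrix.mul_apply, Fintype.sum_prod_type, Matrix.one_apply]

theorem mul_one_kronecker_apply (C : Matrix a b ℂ) (M : Matrix n (r × a) ℂ) (x : r) (k : b)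
    (y : n) : (M * ((1 : Matrix r r ℂ) ⊗ₖ C)) y (x, k) = ∑ i, M y (x, i) * C i k := by
  simp [Matrix.mul_apply, Fintype.sum_prod_type, Matrix.one_apply]

theorem idTensor_kronecker_one_mul (Φ : Matrix a a ℂ →ₗ[ℂ] Matrix b b ℂ) (V : Matrix r r ℂ)
    (M : Matrix (r × a) (r × a) ℂ) :
    idTensor r Φ ((V ⊗ₖ (1 : Matrix a a ℂ)) * M) = (V ⊗ₖ (1 : Matrix b b ℂ)) * idTensor r Φ M := by
  ext ⟨x, k⟩ ⟨y, l⟩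
  rw [kronecker_one_mul_apply]
  change Φ _ k l = ∑ z, V x z * Φ (M.submatrix (Prod.mk z) (Prod.mk y)) k l
  have : ((V ⊗ₖ (1 : Matrix a a ℂ)) * M).submatrix (Prod.mk x) (Prod.mk y)
      = ∑ z, V x z • M.submatrix (Prod.mk z) (Prod.mk y) := by
    ext i j
    rw [Matrix.submatrix_apply, kronecker_one_mul_apply]
    simp [Matrix.sum_apply]
  simp only [this, map_sum, map_smul, Matrix.sum_apply, Matrix.smul_apply, smul_eq_mul]

theorem idTensor_mul_kronecker_one (Φ : Matrix a a ℂ →ₗ[ℂ] Matrix b b ℂ) (V : Matrix r r ℂ)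
    (M : Matrix (r × a) (r × a) ℂ) :
    idTensor r Φ (M * (V ⊗ₖ (1 : Matrix a a ℂ))) = idTensor r Φ M * (V ⊗ₖ (1 : Matrix b b ℂ)) := by
  ext ⟨y, l⟩ ⟨x, k⟩
  rw [mul_kronecker_one_apply]
  change Φ _ l k = ∑ z, Φ (M.submatrix (Prod.mk y) (Prod.mk z)) l k * V z x
  have : (M * (V ⊗ₖ (1 : Matrix a a ℂ))).submatrix (Prod.mk y) (Prod.mk x)
      = ∑ z, V z x • M.submatrix (Prod.mk y) (Prod.mk z) := by
    ext i j
    rw [Matrix.submatrix_apply, mul_kronecker_one_apply]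
    simp [Matrix.sum_apply, mul_comm]
  simp only [this, map_sum, map_smul, Matrix.sum_apply, Matrix.smul_apply, smul_eq_mul, mul_comm]

theorem trace_eq_sum_trace_blocks (M : Matrix (r × a) (r × a) ℂ) :
    M.trace = (∑ x, M.submatrix (Prod.mk x) (Prod.mk x)).trace := by
  simp [Matrix.trace, Fintype.sum_prod_type, Matrix.sum_apply]
  rw [Finset.sum_comm]

theorem trace_idTensor (Φ : Matrix a a ℂ →ₗ[ℂ] Matrix b b ℂ) (M : Matrix (r × a) (r × a) ℂ) :
    (idTensor r Φ M).trace = (Φ (∑ x, M.submatrix (Prod.mk x) (Prod.mk x))).trace := by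
  rw [trace_eq_sum_trace_blocks, map_sum]
  rfl

theorem IsTracePreserving.trace_idTensor {Φ : Matrix a a ℂ →ₗ[ℂ] Matrix b b ℂ}
    (hΦ : IsTracePreserving Φ) (M : Matrix (r × a) (r × a) ℂ) :
    (idTensor r Φ M).trace = M.trace := by
  rw [LinearMapSimulation.trace_idTensor, hΦ, ← trace_eq_sum_trace_blocks]

theorem IsTraceNonincreasing.trace_idTensor_le {Φ : Matrix a a ℂ →ₗ[ℂ] Matrix b b ℂ}
    (hΦ : IsTraceNonincreasing Φ) {M : Matrix (r × a) (r × a) ℂ} (hM : M.PosSemidef) :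
    (idTensor r Φ M).trace.re ≤ M.trace.re := by
  rw [LinearMapSimulation.trace_idTensor, trace_eq_sum_trace_blocks M]
  exact hΦ _ (Matrix.posSemidef_sum _ fun x _ => hM.submatrix _)

/-- Both `Z + Zᴴ` and `i(Z - Zᴴ)` are Hermitian; comparing their images with the adjoints determines
`Φ Zᴴ`. -/
theorem IsHermitianPreserving.map_conjTranspose {Φ : Matrix a a ℂ →ₗ[ℂ] Matrix b b ℂ}
    (hΦ : IsHermitianPreserving Φ) (Z : Matrix a a ℂ) : Φ Zᴴ = (Φ Z)ᴴ := by
  have h1 : (Φ (Z + Zᴴ)).IsHermitian := hΦ _ (Matrix.isHermitian_add_transpose_self Z)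
  have h2 : (Φ (Complex.I • (Z - Zᴴ))).IsHermitian := by
    refine hΦ _ ?_
    rw [Matrix.IsHermitian, Matrix.conjTranspose_smul, Matrix.conjTranspose_sub,
      Matrix.conjTranspose_conjTranspose, ← neg_sub Z, Complex.star_def, Complex.conj_I,
      neg_smul, smul_neg, neg_neg]
  have h1 := h1.eq
  have h2 := h2.eq
  rw [map_add, Matrix.conjTranspose_add] at h1
  rw [map_smul, Matrix.conjTranspose_smul, map_sub, Matrix.conjTranspose_sub] at h2
  ext i j
  have e1 := congrFun (congrFun h1 i) j
  have e2 := congrFun (congrFun h2 i) j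
  simp only [Matrix.add_apply, Matrix.smul_apply, Matrix.sub_apply, smul_eq_mul, Complex.star_def,
    Complex.conj_I] at e1 e2
  have e3 := mul_left_cancel₀ Complex.I_ne_zero
    (show Complex.I * ((Φ Zᴴ)ᴴ i j - (Φ Z)ᴴ i j) = Complex.I * (Φ Z i j - Φ Zᴴ i j) by
      linear_combination e2)
  linear_combination -(e1 - e3) / 2

theorem IsHermitianPreserving.isHermitian_idTensor {Φ : Matrix a a ℂ →ₗ[ℂ] Matrix b b ℂ}
    (hΦ : IsHermitianPreserving Φ) {M : Matrix (r × a) (r × a) ℂ} (hM : M.IsHermitian) :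
    (idTensor r Φ M).IsHermitian := by
  ext p q
  change star (Φ (M.submatrix (Prod.mk q.1) (Prod.mk p.1)) q.2 p.2)
    = Φ (M.submatrix (Prod.mk p.1) (Prod.mk q.1)) p.2 q.2
  rw [← Matrix.conjTranspose_apply, ← hΦ.map_conjTranspose, Matrix.conjTranspose_submatrix, hM.eq]

/-- A CPTNI map, extended by a reference system, contracts the trace norm of Hermitian
operators. -/
theorem traceNorm_idTensor_le {Φ : Matrix a a ℂ →ₗ[ℂ] Matrix b b ℂ} (hΦ : IsCPTNI Φ)
    {i : r → a} {p : a → r} (hip : ∀ x, p (i x) = x)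
    {M : Matrix (r × a) (r × a) ℂ} (hM : M.IsHermitian) :
    traceNorm (idTensor r Φ M) ≤ traceNorm M := by
  obtain ⟨P, N, hP, hN, rfl, h⟩ := exists_jordan_decomposition hM
  rw [h, map_sub]
  refine (traceNorm_sub_le (hΦ.1.posSemidef_idTensor hip hP)
    (hΦ.1.posSemidef_idTensor hip hN)).trans ?_
  exact add_le_add (hΦ.2.trace_idTensor_le hP) (hΦ.2.trace_idTensor_le hN)

end IdTensor

/-! ### Choi operators and partial traces -/

section Choi

variable {a b r : Type*} [Fintype a] [DecidableEq a] [Fintype b] [DecidableEq b]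
  [Fintype r] [DecidableEq r]

/-- The unnormalised maximally entangled operator. -/
def maxEntangled (a : Type*) [DecidableEq a] : Matrix (a × a) (a × a) ℂ :=
  Matrix.of fun p q => if p.1 = p.2 ∧ q.1 = q.2 then 1 else 0

theorem posSemidef_maxEntangled : (maxEntangled a).PosSemidef := by
  have h : maxEntangled a = Matrix.vecMulVec (fun p : a × a => if p.1 = p.2 then (1 : ℂ) else 0)
      (star fun p : a × a => if p.1 = p.2 then (1 : ℂ) else 0) := by
    ext p q
    by_cases h1 : p.1 = p.2 <;> by_cases h2 : q.1 = q.2 <;>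
      simp [maxEntangled, Matrix.vecMulVec_apply, h1, h2]
  rw [h]
  exact Matrix.posSemidef_vecMulVec_self_star _

/-- The Choi operator of a linear map. -/
def choi (Φ : Matrix a a ℂ →ₗ[ℂ] Matrix b b ℂ) : Matrix (a × b) (a × b) ℂ :=
  idTensor a Φ (maxEntangled a)

theorem choi_apply (Φ : Matrix a a ℂ →ₗ[ℂ] Matrix b b ℂ) (i j : a) (k l : b) :
    choi Φ (i, k) (j, l) = Φ (Matrix.single i j 1) k l := by
  have : (maxEntangled a).submatrix (Prod.mk i) (Prod.mk j) = Matrix.single i j 1 := by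
    ext x y
    simp [maxEntangled, Matrix.single_apply]
  rw [← this]
  rfl

/-- The linear map with a given Choi operator. -/
def ofChoi (P : Matrix (a × b) (a × b) ℂ) : Matrix a a ℂ →ₗ[ℂ] Matrix b b ℂ where
  toFun Z := Matrix.of fun k l => ∑ i, ∑ j, Z i j * P (i, k) (j, l)
  map_add' Z W := by
    ext k l
    simp [add_mul, Finset.sum_add_distrib]
  map_smul' c Z := by
    ext k l
    simp [Finset.mul_sum, mul_assoc]

theorem ofChoi_apply (P : Matrix (a × b) (a × b) ℂ) (Z : Matrix a a ℂ) (k l : b) :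
    ofChoi P Z k l = ∑ i, ∑ j, Z i j * P (i, k) (j, l) := rfl

theorem ofChoi_choi (Φ : Matrix a a ℂ →ₗ[ℂ] Matrix b b ℂ) : ofChoi (choi Φ) = Φ := by
  ext Z k l
  rw [ofChoi_apply]
  conv_rhs => rw [Matrix.matrix_eq_sum_single Z]
  simp only [map_sum, Matrix.sum_apply, choi_apply]
  refine Finset.sum_congr rfl fun i _ => Finset.sum_congr rfl fun j _ => ?_
  rw [show Matrix.single i j (Z i j) = Z i j • Matrix.single i j (1 : ℂ) by simp, map_smul]
  rfl

theorem ofChoi_sub (P Q : Matrix (a × b) (a × b) ℂ) (Z : Matrix a a ℂ) :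
    ofChoi (P - Q) Z = ofChoi P Z - ofChoi Q Z := by
  ext k l
  simp [ofChoi_apply, mul_sub, Finset.sum_sub_distrib]

/-- The columns of a square root of `P` are Kraus operators for the map. This is the direction of
Choi's theorem that makes the simulating maps completely positive. -/
theorem posSemidef_idTensor_ofChoi {P : Matrix (a × b) (a × b) ℂ} (hP : P.PosSemidef)
    {M : Matrix (r × a) (r × a) ℂ} (hM : M.PosSemidef) :
    (idTensor r (ofChoi P) M).PosSemidef := by
  obtain ⟨B, hB, rfl⟩ := exists_posSemidef_sqrt hP
  have h : idTensor r (ofChoi (B * B)) M = ∑ m : a × b,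
      ((1 : Matrix r r ℂ) ⊗ₖ (Matrix.of fun k i => B (i, k) m : Matrix b a ℂ)) * M *
      ((1 : Matrix r r ℂ) ⊗ₖ (Matrix.of fun k i => B (i, k) m : Matrix b a ℂ))ᴴ := by
    ext ⟨x, k⟩ ⟨y, l⟩
    have hB' : ∀ m j l, star (B (j, l) m) = B m (j, l) := fun m j l => hB.isHermitian.apply _ _
    change ∑ i, ∑ j, M (x, i) (y, j) * (B * B) (i, k) (j, l) = _
    simp only [Matrix.sum_apply, Matrix.conjTranspose_kronecker, Matrix.conjTranspose_one,
      mul_one_kronecker_apply, one_kronecker_mul_apply, Matrix.conjTranspose_apply,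
      Matrix.of_apply, hB']
    simp only [Matrix.mul_apply, Finset.mul_sum, Finset.sum_mul]
    conv_rhs => rw [Finset.sum_comm]
    rw [Finset.sum_comm]
    refine Finset.sum_congr rfl fun j _ => ?_
    rw [Finset.sum_comm]
    exact Finset.sum_congr rfl fun m _ => Finset.sum_congr rfl fun i _ => by ring
  rw [h]
  exact Matrix.posSemidef_sum _ fun m _ => hM.mul_mul_conjTranspose_same _

/-- The partial trace over the second system. -/
def partialTrace (P : Matrix (a × b) (a × b) ℂ) : Matrix a a ℂ :=
  Matrix.of fun i j => ∑ k, P (i, k) (j, k)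

theorem trace_ofChoi (P : Matrix (a × b) (a × b) ℂ) (Z : Matrix a a ℂ) :
    (ofChoi P Z).trace = (Z * (partialTrace P)ᵀ).trace := by
  simp only [Matrix.trace, Matrix.diag_apply, ofChoi_apply, Matrix.mul_apply,
    Matrix.transpose_apply, partialTrace, Matrix.of_apply, Finset.mul_sum]
  rw [Finset.sum_comm]
  exact Finset.sum_congr rfl fun i _ => Finset.sum_comm

theorem partialTrace_choi {Φ : Matrix a a ℂ →ₗ[ℂ] Matrix b b ℂ} (hΦ : IsTracePreserving Φ) :
    partialTrace (choi Φ) = 1 := by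
  ext i j
  simp only [partialTrace, Matrix.of_apply, choi_apply]
  have := hΦ (Matrix.single i j 1)
  rw [Matrix.trace] at this
  simp only [Matrix.diag_apply] at this
  rw [this, Matrix.one_apply]
  by_cases h : i = j
  · simp [h]
  · simp [h, Matrix.trace_single_eq_of_ne]

theorem trace_partialTrace (P : Matrix (a × b) (a × b) ℂ) : (partialTrace P).trace = P.trace := by
  simp [partialTrace, Matrix.trace, Fintype.sum_prod_type]

theorem partialTrace_sub (P Q : Matrix (a × b) (a × b) ℂ) :
    partialTrace (P - Q) = partialTrace P - partialTrace Q := by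
  ext i j
  simp [partialTrace]

theorem partialTrace_add (P Q : Matrix (a × b) (a × b) ℂ) :
    partialTrace (P + Q) = partialTrace P + partialTrace Q := by
  ext i j
  simp [partialTrace, Finset.sum_add_distrib]

theorem partialTrace_smul (t : ℝ) (P : Matrix (a × b) (a × b) ℂ) :
    partialTrace (t • P) = t • partialTrace P := by
  ext i j
  simp [partialTrace, Finset.mul_sum]

theorem posSemidef_partialTrace {P : Matrix (a × b) (a × b) ℂ} (hP : P.PosSemidef) :
    (partialTrace P).PosSemidef := by
  have : partialTrace P = ∑ k, P.submatrix (fun i => (i, k)) (fun i => (i, k)) := by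
    ext i j
    simp [partialTrace, Matrix.sum_apply]
  rw [this]
  exact Matrix.posSemidef_sum _ fun k _ => hP.submatrix _

theorem trace_mul_partialTrace (S : Matrix a a ℂ) (P : Matrix (a × b) (a × b) ℂ) :
    (S * partialTrace P).trace = ((S ⊗ₖ (1 : Matrix b b ℂ)) * P).trace := by
  simp only [Matrix.trace, Matrix.diag_apply, Fintype.sum_prod_type, kronecker_one_mul_apply]
  simp only [Matrix.mul_apply, partialTrace, Matrix.of_apply, Finset.mul_sum]
  exact Finset.sum_congr rfl fun i _ => Finset.sum_comm

end Choi

/-! ### Compactness of trace-bounded positive operators -/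

section Compactness

variable {n : Type*} [Fintype n] [DecidableEq n]

theorem isClosed_posSemidef : IsClosed {P : Matrix n n ℂ | P.PosSemidef} := by
  simp only [Matrix.posSemidef_iff_dotProduct_mulVec, Matrix.IsHermitian, Set.ofPred_and,
    Set.ofPred_forall]
  refine IsClosed.inter (isClosed_eq (by fun_prop) (by fun_prop)) (isClosed_iInter fun x => ?_)
  simp only [Complex.le_def, Set.ofPred_and]
  refine IsClosed.inter (isClosed_le continuous_const ?_) (isClosed_eq continuous_const ?_)
  · exact Complex.continuous_re.comp (by fun_prop)
  · exact Complex.continuous_im.comp (by fun_prop)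

theorem norm_apply_le_trace {P : Matrix n n ℂ} (hP : P.PosSemidef) (i j : n) :
    ‖P i j‖ ≤ P.trace.re := by
  have hdiag : ∀ k, 0 ≤ (P k k).re := fun k => (Complex.le_def.mp hP.diag_nonneg).1
  have htr : ∀ k, (P k k).re ≤ P.trace.re := fun k => by
    rw [Matrix.trace, Complex.re_sum]
    exact Finset.single_le_sum (f := fun l => (P l l).re) (fun l _ => hdiag l) (Finset.mem_univ k)
  obtain ⟨S, hS, rfl⟩ := exists_posSemidef_sqrt hP
  have hsym : ∀ k l, ‖S k l‖ = ‖S l k‖ := fun k l => by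
    rw [← hS.isHermitian.apply k l, norm_star]
  have hd : ∀ k, ((S * S) k k).re = ∑ l, ‖S k l‖ ^ 2 := fun k => by
    rw [Matrix.mul_apply, Complex.re_sum]
    refine Finset.sum_congr rfl fun l _ => ?_
    rw [← hS.isHermitian.apply l k, Complex.star_def, Complex.mul_conj, Complex.ofReal_re,
      Complex.normSq_eq_norm_sq]
  -- Termwise AM-GM on the product of rows `i` and `j` of the square root `S`.
  have h : ‖(S * S) i j‖ ≤ (((S * S) i i).re + ((S * S) j j).re) / 2 := by
    rw [hd, hd, ← Finset.sum_add_distrib, Finset.sum_div, Matrix.mul_apply]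
    refine (norm_sum_le _ _).trans (Finset.sum_le_sum fun l _ => ?_)
    rw [norm_mul, hsym l j]
    nlinarith [sq_nonneg (‖S i l‖ - ‖S j l‖)]
  linarith [htr i, htr j]

theorem isCompact_posSemidef_trace_le (t : ℝ) :
    IsCompact {P : Matrix n n ℂ | P.PosSemidef ∧ P.trace.re ≤ t} := by
  have hc : IsCompact (Set.univ.pi fun _ : n => Set.univ.pi fun _ : n =>
      Metric.closedBall (0 : ℂ) t) :=
    isCompact_univ_pi fun _ => isCompact_univ_pi fun _ => isCompact_closedBall _ _
  refine IsCompact.of_isClosed_subset hc ?_ ?_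
  · have h : IsClosed {P : Matrix n n ℂ | P.trace.re ≤ t} :=
      isClosed_le (Complex.continuous_re.comp (by fun_prop)) continuous_const
    exact isClosed_posSemidef.inter h
  · rintro P ⟨hP, ht⟩ i - j -
    simpa using (norm_apply_le_trace hP i j).trans ht

end Compactness

/-! ### Duality for the diamond norm -/

section Duality

variable {a b : Type*} [Fintype a] [DecidableEq a] [Fintype b] [DecidableEq b]

/-- A functional on matrices is represented, on Hermitian operators, by a Hermitian operator. -/
theorem exists_isHermitian_trace_eq (f : Matrix a a ℂ →ₗ[ℂ] ℂ) :
    ∃ σ : Matrix a a ℂ, σ.IsHermitian ∧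
      ∀ T : Matrix a a ℂ, T.IsHermitian → (f T).re = (σ * T).trace.re := by
  set τ : Matrix a a ℂ := Matrix.of fun j i => f (Matrix.single i j 1) with hτ
  have hf : ∀ T, f T = (τ * T).trace := by
    intro T
    conv_lhs => rw [Matrix.matrix_eq_sum_single T]
    simp only [map_sum, Matrix.trace, Matrix.diag_apply, Matrix.mul_apply, hτ, Matrix.of_apply]
    rw [Finset.sum_comm]
    refine Finset.sum_congr rfl fun i _ => Finset.sum_congr rfl fun j _ => ?_
    rw [show Matrix.single j i (T j i) = T j i • Matrix.single j i (1 : ℂ) by simp, map_smul,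
      smul_eq_mul, mul_comm]
  -- For Hermitian `T`, `Tr(τᴴ T)` is the conjugate of `Tr(τ T)`, so the Hermitian part of `τ` gives
  -- the real part of `f T`.
  refine ⟨(1 / 2 : ℝ) • (τ + τᴴ), ?_, fun T hT => ?_⟩
  · rw [Matrix.IsHermitian, Matrix.conjTranspose_smul, Matrix.conjTranspose_add,
      Matrix.conjTranspose_conjTranspose, add_comm]
    simp
  · have h : (τᴴ * T).trace = star (τ * T).trace := by
      rw [← Matrix.trace_conjTranspose, Matrix.conjTranspose_mul, hT.eq, Matrix.trace_mul_comm]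
    rw [hf, Matrix.smul_mul, Matrix.add_mul, Matrix.trace_smul, Matrix.trace_add, h]
    simp
    ring

theorem posSemidef_of_trace_mul_nonneg {σ : Matrix a a ℂ} (hσ : σ.IsHermitian)
    (h : ∀ Q : Matrix a a ℂ, Q.PosSemidef → 0 ≤ (σ * Q).trace.re) : σ.PosSemidef := by
  refine Matrix.PosSemidef.of_dotProduct_mulVec_nonneg hσ fun x => ?_
  have h1 := h _ (Matrix.posSemidef_vecMulVec_self_star x)
  rw [Matrix.mul_vecMulVec, Matrix.trace_vecMulVec, dotProduct_comm] at h1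
  rw [Complex.le_def]
  exact ⟨h1, (hσ.im_star_dotProduct_mulVec_self x).symm⟩

/-- The operators dominating the partial trace of some positive `P ≥ J`. -/
def dominatingSet (J : Matrix (a × b) (a × b) ℂ) : Set (Matrix a a ℂ) :=
  {T | ∃ P : Matrix (a × b) (a × b) ℂ, P.PosSemidef ∧ (P - J).PosSemidef ∧
    (T - partialTrace P).PosSemidef}

theorem convex_dominatingSet (J : Matrix (a × b) (a × b) ℂ) : Convex ℝ (dominatingSet J) := by
  rintro T ⟨P, h1, h2, h3⟩ T' ⟨P', h1', h2', h3'⟩ s t hs ht hst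
  refine ⟨s • P + t • P', (h1.smul hs).add (h1'.smul ht), ?_, ?_⟩
  · have : s • P + t • P' - J = s • (P - J) + t • (P' - J) := by
      have hJ : J = (s + t) • J := by rw [hst, one_smul]
      conv_lhs => rw [hJ]
      module
    rw [this]
    exact (h2.smul hs).add (h2'.smul ht)
  · have : s • T + t • T' - partialTrace (s • P + t • P')
        = s • (T - partialTrace P) + t • (T' - partialTrace P') := by
      rw [partialTrace_add, partialTrace_smul, partialTrace_smul]
      module
    rw [this]
    exact (h3.smul hs).add (h3'.smul ht)

theorem continuous_partialTrace :
    Continuous (partialTrace : Matrix (a × b) (a × b) ℂ → Matrix a a ℂ) := by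
  unfold partialTrace
  fun_prop

/-- A projection of a closed set need not be closed, but here `Tr P ≤ Tr T` confines the witnesses
along a convergent sequence to a compact set, and a subsequence of them converges. -/
theorem isClosed_dominatingSet (J : Matrix (a × b) (a × b) ℂ) : IsClosed (dominatingSet J) := by
  have : FirstCountableTopology (Matrix a a ℂ) :=
    inferInstanceAs (FirstCountableTopology (a → a → ℂ))
  have : FirstCountableTopology (Matrix (a × b) (a × b) ℂ) :=
    inferInstanceAs (FirstCountableTopology (a × b → a × b → ℂ))
  refine IsSeqClosed.isClosed fun T T₀ hT hlim => ?_
  choose P h1 h2 h3 using hT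
  have htr : Filter.Tendsto (fun k => (T k).trace.re) Filter.atTop (nhds T₀.trace.re) :=
    ((Complex.continuous_re.comp (by fun_prop :
      Continuous fun M : Matrix a a ℂ => M.trace)).tendsto T₀).comp hlim
  obtain ⟨t, ht⟩ := htr.bddAbove_range
  have hmem : ∀ k, P k ∈ {P : Matrix (a × b) (a × b) ℂ | P.PosSemidef ∧ P.trace.re ≤ t} := by
    refine fun k => ⟨h1 k, ?_⟩
    have h := trace_re_nonneg (h3 k)
    rw [Matrix.trace_sub, trace_partialTrace, Complex.sub_re] at h
    have := ht (Set.mem_range_self k)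
    linarith
  obtain ⟨P₀, hP₀, φ, hφ, hP⟩ := (isCompact_posSemidef_trace_le t).tendsto_subseq hmem
  refine ⟨P₀, hP₀.1, ?_, ?_⟩
  · exact isClosed_posSemidef.mem_of_tendsto (hP.sub_const J)
      (Filter.Eventually.of_forall fun k => h2 (φ k))
  · refine isClosed_posSemidef.mem_of_tendsto ((hlim.comp hφ.tendsto_atTop).sub
      ((continuous_partialTrace.tendsto P₀).comp hP))
      (Filter.Eventually.of_forall fun k => h3 (φ k))

/-- For a positive definite weight `σ`, the weighted problem dual to the trace norm of
`(√σ ⊗ 1) J (√σ ⊗ 1)` is solved by the Jordan decomposition of that operator. -/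
theorem exists_dominating_of_posDef [Nonempty a] {Φ : Matrix a a ℂ →ₗ[ℂ] Matrix b b ℂ}
    (hΦ : IsHermitianPreserving Φ) (hTP : IsTracePreserving Φ) {c : ℝ}
    (hc : ∀ ρ : Matrix (a × a) (a × a) ℂ, IsDensity ρ → traceNorm (idTensor a Φ ρ) ≤ 2 * c - 1)
    {σ : Matrix a a ℂ} (hσ : σ.PosDef) :
    ∃ P : Matrix (a × b) (a × b) ℂ, P.PosSemidef ∧ (P - choi Φ).PosSemidef ∧
      (σ * partialTrace P).trace.re ≤ c * σ.trace.re := by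
  obtain ⟨R, hR, hRR⟩ := exists_posSemidef_sqrt hσ.posSemidef
  have hRu : IsUnit R.det := by
    have h := (Matrix.isUnit_iff_isUnit_det _).mp hσ.isUnit
    rw [← hRR, Matrix.det_mul] at h
    exact isUnit_of_mul_isUnit_left h
  set s : ℝ := σ.trace.re with hs
  have hs0 : 0 < s := (Complex.lt_def.mp hσ.trace_pos).1
  have hsσ : σ.trace = (s : ℂ) := by
    apply Complex.ext
    · simp [hs]
    · simpa using trace_im_eq_zero hσ.isHermitian
  set A : Matrix (a × b) (a × b) ℂ := R ⊗ₖ 1 with hA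
  set B : Matrix (a × b) (a × b) ℂ := R⁻¹ ⊗ₖ 1 with hB
  have hAB : A * B = 1 := by
    rw [hA, hB, ← Matrix.mul_kronecker_mul, Matrix.mul_nonsing_inv _ hRu, Matrix.one_mul,
      Matrix.one_kronecker_one]
  have hBA : B * A = 1 := by
    rw [hA, hB, ← Matrix.mul_kronecker_mul, Matrix.nonsing_inv_mul _ hRu, Matrix.one_mul,
      Matrix.one_kronecker_one]
  have hAA : A * A = σ ⊗ₖ 1 := by
    rw [hA, ← Matrix.mul_kronecker_mul, hRR, Matrix.one_mul]
  have hBh : Bᴴ = B := by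
    rw [hB, Matrix.conjTranspose_kronecker, Matrix.conjTranspose_one, hR.inv.isHermitian.eq]
  -- Up to the factor `s = Tr σ`, this is a density operator. Its image under `id ⊗ Φ` is `A J A`,
  -- so the hypothesis bounds `‖A J A‖₁` by `s(2c - 1)`.
  set ω : Matrix (a × a) (a × a) ℂ :=
    (R ⊗ₖ (1 : Matrix a a ℂ)) * maxEntangled a * (R ⊗ₖ (1 : Matrix a a ℂ)) with hω
  have hωp : ω.PosSemidef := by
    have h := (posSemidef_maxEntangled (a := a)).mul_mul_conjTranspose_same
      (R ⊗ₖ (1 : Matrix a a ℂ))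
    rwa [Matrix.conjTranspose_kronecker, Matrix.conjTranspose_one, hR.isHermitian.eq] at h
  have hωt : ω.trace = (s : ℂ) := by
    have hid : partialTrace (maxEntangled a) = 1 :=
      partialTrace_choi (Φ := (LinearMap.id : Matrix a a ℂ →ₗ[ℂ] Matrix a a ℂ)) fun _ => rfl
    rw [hω, Matrix.trace_mul_comm, ← Matrix.mul_assoc, ← Matrix.mul_kronecker_mul, hRR,
      Matrix.one_mul, ← trace_mul_partialTrace, hid, Matrix.mul_one, hsσ]
  have hJ : idTensor a Φ ω = A * choi Φ * A := by
    rw [hω, idTensor_mul_kronecker_one, idTensor_kronecker_one_mul]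
    rfl
  have hHt : (A * choi Φ * A).trace = (s : ℂ) := by
    rw [← hJ, hTP.trace_idTensor, hωt]
  have hH : (A * choi Φ * A).IsHermitian := by
    rw [← hJ]
    exact hΦ.isHermitian_idTensor hωp.isHermitian
  have hnorm : traceNorm (A * choi Φ * A) ≤ s * (2 * c - 1) := by
    have hsc : (s : ℂ) ≠ 0 := by exact_mod_cast hs0.ne'
    have hρ : IsDensity (((s⁻¹ : ℝ) : ℂ) • ω) := by
      refine ⟨hωp.smul (by simpa using (inv_pos.mpr hs0).le), ?_⟩
      rw [Matrix.trace_smul, hωt, smul_eq_mul, Complex.ofReal_inv, inv_mul_cancel₀ hsc]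
    have h := hc _ hρ
    rw [map_smul, traceNorm_smul (inv_pos.mpr hs0).le, hJ] at h
    rwa [inv_mul_le_iff₀ hs0] at h
  obtain ⟨P, N, hP, hN, hPN, htn⟩ := exists_jordan_decomposition hH
  have hBP : (B * P * B).PosSemidef := by
    have := hP.mul_mul_conjTranspose_same B
    rwa [hBh] at this
  have hBN : (B * N * B).PosSemidef := by
    have := hN.mul_mul_conjTranspose_same B
    rwa [hBh] at this
  -- Undoing the conjugation by `A = √σ ⊗ 1` keeps `P - N` a decomposition into positive parts, now
  -- of `J`, and turns the weighted trace into `Tr P`.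
  refine ⟨B * P * B, hBP, ?_, ?_⟩
  · have : B * P * B - choi Φ = B * N * B := by
      have h : choi Φ = B * (A * choi Φ * A) * B := by
        calc choi Φ = (B * A) * choi Φ * (A * B) := by simp [hBA, hAB]
          _ = _ := by simp only [Matrix.mul_assoc]
      rw [h, hPN, Matrix.mul_sub, Matrix.sub_mul, sub_sub_cancel]
    rwa [this]
  · have h : (σ * partialTrace (B * P * B)).trace = P.trace := by
      rw [trace_mul_partialTrace, ← hAA]
      calc (A * A * (B * P * B)).trace = (A * (A * B) * P * B).trace := by
            simp only [Matrix.mul_assoc]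
        _ = P.trace := by
            rw [hAB, Matrix.mul_one, Matrix.mul_assoc, Matrix.trace_mul_comm, Matrix.mul_assoc,
              hBA, Matrix.mul_one]
    have ht : P.trace.re - N.trace.re = s := by
      rw [← Complex.sub_re, ← Matrix.trace_sub, ← hPN, hHt, Complex.ofReal_re]
    -- `Tr P - Tr N = s` and `Tr P + Tr N ≤ s(2c - 1)` add up to `Tr P ≤ c s`.
    rw [h]
    linarith

/-- Strong duality for the diamond norm. -/
theorem exists_dominating [Nonempty a] {Φ : Matrix a a ℂ →ₗ[ℂ] Matrix b b ℂ}
    (hΦ : IsHermitianPreserving Φ) (hTP : IsTracePreserving Φ) {c : ℝ}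
    (hc : ∀ ρ : Matrix (a × a) (a × a) ℂ, IsDensity ρ → traceNorm (idTensor a Φ ρ) ≤ 2 * c - 1) :
    ∃ P : Matrix (a × b) (a × b) ℂ, P.PosSemidef ∧ (P - choi Φ).PosSemidef ∧
      (c • (1 : Matrix a a ℂ) - partialTrace P).PosSemidef := by
  by_contra hcon
  have : LocallyConvexSpace ℝ (Matrix a a ℂ) :=
    NormedSpace.toLocallyConvexSpace (E := a → a → ℂ)
  obtain ⟨f, u, hf1, hf2⟩ := RCLike.geometric_hahn_banach_point_closed (𝕜 := ℂ)
    (convex_dominatingSet (choi Φ)) (isClosed_dominatingSet (choi Φ))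
    (x := c • (1 : Matrix a a ℂ)) hcon
  obtain ⟨σ, hσ, hσf⟩ := exists_isHermitian_trace_eq f.toLinearMap
  have hσf' : ∀ T : Matrix a a ℂ, T.IsHermitian → RCLike.re (f T) = (σ * T).trace.re := hσf
  have hdom : ∀ P : Matrix (a × b) (a × b) ℂ, P.PosSemidef → (P - choi Φ).PosSemidef →
      ∀ Q : Matrix a a ℂ, Q.PosSemidef → u < (σ * (partialTrace P + Q)).trace.re := by
    intro P hP hP' Q hQ
    rw [← hσf' _ ((posSemidef_partialTrace hP).add hQ).isHermitian]
    exact hf2 _ ⟨P, hP, hP', by simpa using hQ⟩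
  have hH : (choi Φ).IsHermitian := hΦ.isHermitian_idTensor posSemidef_maxEntangled.isHermitian
  obtain ⟨P₀, N₀, hP₀, hN₀, hPN, -⟩ := exists_jordan_decomposition hH
  have hPN' : (P₀ - choi Φ).PosSemidef := by rwa [hPN, sub_sub_cancel]
  -- The dominating set is stable under adding positive operators. Were `Tr(σQ) < 0`, the multiple
  -- of `Q` chosen below would bring the functional down exactly to `u`, which it must exceed.
  have hσp : σ.PosSemidef := by
    refine posSemidef_of_trace_mul_nonneg hσ fun Q hQ => ?_
    by_contra! hneg
    have h0 := hdom P₀ hP₀ hPN' 0 Matrix.PosSemidef.zero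
    rw [add_zero] at h0
    have ht : 0 ≤ (u - (σ * partialTrace P₀).trace.re) / (σ * Q).trace.re :=
      div_nonneg_of_nonpos (by linarith) hneg.le
    have h1 := hdom P₀ hP₀ hPN' _ (hQ.smul ht)
    rw [Matrix.mul_add, Matrix.trace_add, Complex.add_re, Matrix.mul_smul, Matrix.trace_smul,
      Complex.real_smul, Complex.re_ofReal_mul, div_mul_cancel₀ _ hneg.ne] at h1
    linarith
  have hone : (c • (1 : Matrix a a ℂ)).IsHermitian := by
    rw [Matrix.IsHermitian, Matrix.conjTranspose_smul]
    simp
  rw [hσf' _ hone, Matrix.mul_smul, Matrix.mul_one, Matrix.trace_smul, Complex.real_smul,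
    Complex.re_ofReal_mul] at hf1
  -- `σ` may be singular, so `σ + ε • 1` is used instead. This adds `ε c dim A` to the upper bound,
  -- and `ε` is chosen to keep that below the gap `u - c Tr σ`; the `+ 1` keeps the denominator
  -- positive and the inequality strict.
  set n : ℝ := |c * Fintype.card a| + 1 with hn
  have hn0 : 0 < n := by positivity
  set ε : ℝ := (u - c * σ.trace.re) / n with hε
  have hε0 : 0 < ε := div_pos (by linarith) hn0
  have hεn : ε * n = u - c * σ.trace.re := div_mul_cancel₀ _ hn0.ne'
  obtain ⟨P, hP, hP', hle⟩ := exists_dominating_of_posDef hΦ hTP hc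
    (Matrix.PosDef.posSemidef_add hσp ((Matrix.PosDef.one (n := a) (R := ℂ)).smul hε0))
  have h1 := hdom P hP hP' 0 Matrix.PosSemidef.zero
  rw [add_zero] at h1
  rw [Matrix.add_mul, Matrix.trace_add, Complex.add_re, Matrix.trace_add, Complex.add_re,
    Matrix.smul_mul, Matrix.one_mul, Matrix.trace_smul, Matrix.trace_smul, Complex.real_smul,
    Complex.real_smul, Complex.re_ofReal_mul, Complex.re_ofReal_mul, Matrix.trace_one,
    Complex.natCast_re, trace_partialTrace] at hle
  have h2 := mul_nonneg hε0.le (trace_re_nonneg hP)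
  have h3 : ε * (c * Fintype.card a) < ε * n :=
    mul_lt_mul_of_pos_left (by rw [hn]; linarith [le_abs_self (c * Fintype.card a)]) hε0
  linarith

end Duality

/-! ### Attained maximum and the lower bound -/

section Values

variable {a b : Type*} [Fintype a] [DecidableEq a] [Fintype b] [DecidableEq b]

theorem isCompact_isDensity : IsCompact {ρ : Matrix a a ℂ | IsDensity ρ} := by
  refine (isCompact_posSemidef_trace_le 1).of_isClosed_subset ?_ ?_
  · have h : IsClosed {ρ : Matrix a a ℂ | ρ.trace = 1} :=
      isClosed_eq (by fun_prop) continuous_const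
    exact isClosed_posSemidef.inter h
  · rintro ρ ⟨h1, h2⟩
    exact ⟨h1, by simp [h2]⟩

theorem exists_isDensity (a : Type*) [Fintype a] [DecidableEq a] [Nonempty a] :
    ∃ ρ : Matrix a a ℂ, IsDensity ρ := by
  obtain ⟨i⟩ := ‹Nonempty a›
  refine ⟨Matrix.diagonal (Pi.single i 1), Matrix.PosSemidef.diagonal ?_, ?_⟩
  · simp
  · simp [Matrix.trace_diagonal]

/-- The maximum defining the diamond norm is attained. -/
theorem exists_isGreatest_diamondValues [Nonempty a] {Φ : Matrix a a ℂ →ₗ[ℂ] Matrix b b ℂ}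
    (hΦ : IsHermitianPreserving Φ) : ∃ d, IsGreatest (diamondValues Φ) d := by
  have hcont : Continuous (idTensor a Φ) := by
    refine continuous_matrix fun p q => ?_
    change Continuous fun M : Matrix (a × a) (a × a) ℂ =>
      Φ (M.submatrix (Prod.mk p.1) (Prod.mk q.1)) p.2 q.2
    have hΦc : Continuous Φ := Φ.continuous_of_finiteDimensional
    exact (hΦc.comp (by fun_prop)).matrix_elem _ _
  have hc : ContinuousOn (fun ρ => traceNorm (idTensor a Φ ρ))
      {ρ : Matrix (a × a) (a × a) ℂ | IsDensity ρ} :=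
    continuousOn_traceNorm.comp hcont.continuousOn fun ρ hρ =>
      hΦ.isHermitian_idTensor hρ.1.isHermitian
  obtain ⟨ρ, hρ, hmax⟩ := isCompact_isDensity.exists_isMaxOn (exists_isDensity (a × a)) hc
  refine ⟨_, ⟨ρ, hρ, rfl⟩, ?_⟩
  rintro t ⟨ρ', hρ', rfl⟩
  exact hmax hρ'

theorem one_le_of_mem_diamondValues {Φ : Matrix a a ℂ →ₗ[ℂ] Matrix b b ℂ}
    (hΦ : IsHermitianPreserving Φ) (hTP : IsTracePreserving Φ) {t : ℝ}
    (ht : t ∈ diamondValues Φ) : 1 ≤ t := by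
  obtain ⟨ρ, hρ, rfl⟩ := ht
  have := trace_re_le_traceNorm (hΦ.isHermitian_idTensor hρ.1.isHermitian)
  rwa [hTP.trace_idTensor, hρ.2, Complex.one_re] at this

theorem le_of_mem_diamondValues_of_mem_amortisedValues {Φ : Matrix a a ℂ →ₗ[ℂ] Matrix b b ℂ}
    {s t : ℝ} (hs : s ∈ diamondValues Φ) (ht : t ∈ amortisedValues Φ) : s ≤ t := by
  obtain ⟨ρ, hρ, rfl⟩ := hs
  obtain ⟨n, m, X, Y, Λ, hX, hY, hXt, hYt, hΛ, hsim, rfl⟩ := ht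
  have hYpos : 0 < traceNorm Y := by
    have := trace_re_le_traceNorm hY
    rw [hYt, Complex.one_re] at this
    linarith
  -- A basis vector of the ancilla embeds the reference `a` into `a × Fin n`, the reference used in
  -- the complete positivity of `Λ`.
  obtain ⟨x⟩ : Nonempty (Fin n) := by
    by_contra h
    rw [not_nonempty_iff] at h
    simp [Matrix.trace] at hXt
  set M : Matrix (a × (a × Fin n)) (a × (a × Fin n)) ℂ :=
    (ρ ⊗ₖ X).submatrix (Equiv.prodAssoc a a (Fin n)).symm (Equiv.prodAssoc a a (Fin n)).symm
    with hM
  have hMh : M.IsHermitian := by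
    have : (ρ ⊗ₖ X).IsHermitian := by
      rw [Matrix.IsHermitian, Matrix.conjTranspose_kronecker, hρ.1.isHermitian.eq, hX.eq]
    exact this.submatrix _
  have hMt : traceNorm M = traceNorm X := by
    rw [hM, traceNorm_submatrix_equiv, traceNorm_kronecker, traceNorm_posSemidef hρ.1, hρ.2,
      Complex.one_re, one_mul]
  have hΛM : idTensor a Λ M = (idTensor a Φ ρ ⊗ₖ Y).submatrix (Equiv.prodAssoc a b (Fin m)).symm
      (Equiv.prodAssoc a b (Fin m)).symm := by
    ext p q
    change Λ (ρ.submatrix (Prod.mk p.1) (Prod.mk q.1) ⊗ₖ X) p.2 q.2 = _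
    rw [hsim]
    rfl
  have h := traceNorm_idTensor_le hΛ (i := fun y : a => (y, x)) (p := Prod.fst) (fun _ => rfl) hMh
  rw [hΛM, traceNorm_submatrix_equiv, traceNorm_kronecker, hMt] at h
  rwa [le_div_iff₀ hYpos]

theorem simulationValues_subset_amortisedValues (Φ : Matrix a a ℂ →ₗ[ℂ] Matrix b b ℂ) :
    simulationValues Φ ⊆ amortisedValues Φ := by
  rintro t ⟨n, X, Λ, hX, hXt, hΛ, hsim, rfl⟩
  refine ⟨n, 1, X, 1, Matrix.reindexLinearEquiv ℂ ℂ (Equiv.prodUnique b (Fin 1)).symm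
    (Equiv.prodUnique b (Fin 1)).symm ∘ₗ Λ, hX, Matrix.isHermitian_one, hXt, by simp, ⟨?_, ?_⟩,
    fun Z => ?_, ?_⟩
  · intro M hM
    exact (hΛ.1 M hM).submatrix (Prod.map id (Equiv.prodUnique b (Fin 1)))
  · intro M hM
    refine le_trans (le_of_eq ?_) (hΛ.2 M hM)
    congr 1
    simp only [Matrix.trace]
    exact Equiv.sum_comp (Equiv.prodUnique b (Fin 1)) fun i => Λ M i i
  · ext p q
    have : (1 : Matrix (Fin 1) (Fin 1) ℂ) p.2 q.2 = 1 := by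
      rw [Subsingleton.elim p.2 q.2, Matrix.one_apply_eq]
    rw [Matrix.kroneckerMap_apply, this, mul_one, ← hsim]
    rfl
  · rw [traceNorm_posSemidef Matrix.PosSemidef.one]
    simp

/-! ### Optimal simulation with a qubit ancilla -/

/-- The map measuring a qubit ancilla and applying one of two maps according to the outcome. -/
def controlled (Ψ₀ Ψ₁ : Matrix a a ℂ →ₗ[ℂ] Matrix b b ℂ) :
    Matrix (a × Fin 2) (a × Fin 2) ℂ →ₗ[ℂ] Matrix b b ℂ where
  toFun M := Ψ₀ (M.submatrix (fun i => (i, 0)) fun i => (i, 0))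
    + Ψ₁ (M.submatrix (fun i => (i, 1)) fun i => (i, 1))
  map_add' M N := by
    simp only [Matrix.submatrix_add, Pi.add_apply, map_add]
    abel
  map_smul' t M := by
    simp [Matrix.submatrix_smul]

theorem controlled_apply (Ψ₀ Ψ₁ : Matrix a a ℂ →ₗ[ℂ] Matrix b b ℂ)
    (M : Matrix (a × Fin 2) (a × Fin 2) ℂ) :
    controlled Ψ₀ Ψ₁ M = Ψ₀ (M.submatrix (fun i => (i, 0)) fun i => (i, 0))
      + Ψ₁ (M.submatrix (fun i => (i, 1)) fun i => (i, 1)) := rfl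

theorem isCPTNI_controlled {P Q : Matrix (a × b) (a × b) ℂ} (hP : P.PosSemidef)
    (hQ : Q.PosSemidef) {s t : ℝ} (hs : 0 ≤ s) (ht : 0 ≤ t)
    (hP1 : (1 - (s : ℂ) • partialTrace P).PosSemidef)
    (hQ1 : (1 - (t : ℂ) • partialTrace Q).PosSemidef) :
    IsCPTNI (controlled ((s : ℂ) • ofChoi P) ((t : ℂ) • ofChoi Q)) := by
  have hs' : (0 : ℂ) ≤ s := by simpa using hs
  have ht' : (0 : ℂ) ≤ t := by simpa using ht
  have key : ∀ {P : Matrix (a × b) (a × b) ℂ} {s : ℝ}, (1 - (s : ℂ) • partialTrace P).PosSemidef →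
      ∀ Z : Matrix a a ℂ, Z.PosSemidef → (((s : ℂ) • ofChoi P) Z).trace.re ≤ Z.trace.re := by
    intro P s h Z hZ
    -- With this Choi convention `Tr Ψ(Z) = Tr(Z (Tr_B P)ᵀ)`, hence the transpose.
    have := trace_mul_re_nonneg hZ h.transpose
    rw [Matrix.transpose_sub, Matrix.transpose_one, Matrix.transpose_smul, Matrix.mul_sub,
      Matrix.mul_one, Matrix.trace_sub, Matrix.mul_smul, Matrix.trace_smul, ← trace_ofChoi,
      ← Matrix.trace_smul, Complex.sub_re] at this
    rw [LinearMap.smul_apply]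
    linarith
  refine ⟨fun M hM => ?_, fun M hM => ?_⟩
  · have h0 := (posSemidef_idTensor_ofChoi hP (hM.submatrix
      (Prod.map id fun i : a => (i, (0 : Fin 2))))).smul hs'
    have h1 := (posSemidef_idTensor_ofChoi hQ (hM.submatrix
      (Prod.map id fun i : a => (i, (1 : Fin 2))))).smul ht'
    exact h0.add h1
  · have h0 := key hP1 _ (hM.submatrix fun i => (i, (0 : Fin 2)))
    have h1 := key hQ1 _ (hM.submatrix fun i => (i, (1 : Fin 2)))
    rw [controlled_apply, Matrix.trace_add, Complex.add_re]
    refine (add_le_add h0 h1).trans (le_of_eq ?_)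
    simp [Matrix.trace, Fintype.sum_prod_type, Finset.sum_add_distrib]

theorem controlled_kronecker_diagonal (Ψ₀ Ψ₁ : Matrix a a ℂ →ₗ[ℂ] Matrix b b ℂ) (x y : ℂ)
    (Z : Matrix a a ℂ) :
    controlled Ψ₀ Ψ₁ (Z ⊗ₖ Matrix.diagonal ![x, y]) = x • Ψ₀ Z + y • Ψ₁ Z := by
  rw [controlled_apply, ← map_smul, ← map_smul]
  congr 2 <;> · ext i j; simp [mul_comm]

/-- A positive operator dominating the Choi operator, with bounded partial trace, yields a
simulation with a qubit ancilla. -/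
theorem mem_simulationValues {Φ : Matrix a a ℂ →ₗ[ℂ] Matrix b b ℂ} (hTP : IsTracePreserving Φ)
    {c : ℝ} (hc : 1 ≤ c) {P : Matrix (a × b) (a × b) ℂ} (hP : P.PosSemidef)
    (hP' : (P - choi Φ).PosSemidef) (hPc : (c • (1 : Matrix a a ℂ) - partialTrace P).PosSemidef) :
    2 * c - 1 ∈ simulationValues Φ := by
  set N := P - choi Φ with hN
  have hc0 : 0 < c := by linarith
  have hcc : (c : ℂ) ≠ 0 := by exact_mod_cast hc0.ne'
  have hNc : ((c - 1) • (1 : Matrix a a ℂ) - partialTrace N).PosSemidef := by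
    rw [hN, partialTrace_sub, partialTrace_choi hTP]
    convert hPc using 1
    module
  refine ⟨2, Matrix.diagonal ![(c : ℂ), ((-(c - 1) : ℝ) : ℂ)],
    controlled (((c⁻¹ : ℝ) : ℂ) • ofChoi P) ((((c - 1)⁻¹ : ℝ) : ℂ) • ofChoi N), ?_, ?_,
    isCPTNI_controlled hP hP' (by positivity) (inv_nonneg.mpr (by linarith)) ?_ ?_,
    fun Z => ?_, ?_⟩
  · refine Matrix.isHermitian_diagonal_of_self_adjoint _ ?_
    ext i
    fin_cases i <;> simp
  · simp [Matrix.trace_diagonal]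
  · have h := hPc.smul (inv_nonneg.mpr hc0.le)
    rwa [smul_sub, smul_smul, inv_mul_cancel₀ hc0.ne', one_smul] at h
  · rcases hc.eq_or_lt with rfl | hlt
    · simpa using Matrix.PosSemidef.one
    · have h := hNc.smul (inv_nonneg.mpr (sub_pos.mpr hlt).le)
      rwa [smul_sub, smul_smul, inv_mul_cancel₀ (sub_pos.mpr hlt).ne', one_smul] at h
  -- At `c = 1` the inverse is `0` by convention and the left side vanishes. The identity survives
  -- because `Tr_B N ≤ 0` with `N ≥ 0` forces `N = 0`.
  · have hN1 : (-(c - 1) : ℝ) • (((c - 1)⁻¹ : ℝ) • ofChoi N Z) = -ofChoi N Z := by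
      rcases hc.eq_or_lt with rfl | hlt
      · have hN0 : N = 0 := by
          have h1 := trace_re_nonneg hNc
          rw [sub_self, zero_smul, zero_sub, Matrix.trace_neg, trace_partialTrace,
            Complex.neg_re] at h1
          have h2 := trace_re_nonneg hP'
          refine hP'.trace_eq_zero_iff.mp (Complex.ext ?_ (trace_im_eq_zero hP'.isHermitian))
          rw [Complex.zero_re]
          linarith
        rw [hN0]
        have : ofChoi (0 : Matrix (a × b) (a × b) ℂ) Z = 0 := by
          ext k l
          simp [ofChoi_apply]
        simp [this]
      · rw [smul_smul, neg_mul, mul_inv_cancel₀ (sub_pos.mpr hlt).ne', neg_one_smul]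
    rw [controlled_kronecker_diagonal, LinearMap.smul_apply, LinearMap.smul_apply, smul_smul,
      Complex.ofReal_inv, mul_inv_cancel₀ hcc, one_smul]
    refine (congrArg (ofChoi P Z + ·) hN1).trans ?_
    rw [← sub_eq_add_neg, ← ofChoi_sub, hN, sub_sub_cancel, ofChoi_choi]
  · have hS : (Matrix.diagonal ![(c : ℂ), ((c - 1 : ℝ) : ℂ)]).PosSemidef := by
      refine Matrix.PosSemidef.diagonal fun i => ?_
      fin_cases i
      · simpa using hc0.le
      · simpa [← Complex.ofReal_one, ← Complex.ofReal_sub] using hc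
    rw [traceNorm_eq_of_mul_self hS]
    · simp [Matrix.trace_diagonal]
      ring
    · rw [Matrix.diagonal_conjTranspose, Matrix.diagonal_mul_diagonal,
        Matrix.diagonal_mul_diagonal]
      congr 1
      ext i
      fin_cases i <;> simp
      ring

end Values

end LinearMapSimulation

theorem corollary2 {a b : Type*} [Fintype a] [DecidableEq a] [Nonempty a]
    [Fintype b] [DecidableEq b]
    (Φ : Matrix a a ℂ →ₗ[ℂ] Matrix b b ℂ)
    (hΦ : IsHermitianPreserving Φ) (hTP : IsTracePreserving Φ) :
    IsGreatest (diamondValues Φ) (diamondNorm Φ) ∧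
    IsLeast (simulationValues Φ) (simulationCost Φ) ∧
    IsLeast (amortisedValues Φ) (amortisedCost Φ) ∧
    amortisedCost Φ = simulationCost Φ ∧
    simulationCost Φ = diamondNorm Φ := by
  obtain ⟨d, hd⟩ := exists_isGreatest_diamondValues hΦ
  have hd1 : 1 ≤ d := one_le_of_mem_diamondValues hΦ hTP hd.1
  -- This `c` solves `2c - 1 = d`; the bound `1 ≤ d` gives the `1 ≤ c` needed for a nonnegative
  -- weight `c - 1`.
  obtain ⟨P, hP, hP', hPc⟩ := exists_dominating hΦ hTP (c := (d + 1) / 2) fun ρ hρ =>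
    (hd.2 ⟨ρ, hρ, rfl⟩).trans (by linarith)
  have hmem : d ∈ simulationValues Φ := by
    have := mem_simulationValues hTP (by linarith) hP hP' hPc
    rwa [show 2 * ((d + 1) / 2) - 1 = d by ring] at this
  have hA : IsLeast (amortisedValues Φ) d :=
    ⟨simulationValues_subset_amortisedValues Φ hmem,
      fun t ht => le_of_mem_diamondValues_of_mem_amortisedValues hd.1 ht⟩
  have hS : IsLeast (simulationValues Φ) d :=
    ⟨hmem, fun t ht => hA.2 (simulationValues_subset_amortisedValues Φ ht)⟩
  have e1 : diamondNorm Φ = d := hd.csSup_eq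
  have e2 : simulationCost Φ = d := hS.csInf_eq
  have e3 : amortisedCost Φ = d := hA.csInf_eq
  rw [e1, e2, e3]
  exact ⟨hd, hS, hA, rfl, rfl⟩
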